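/- Let $R=(r_1,\dots,r_m)$ and $C=(c_1,\dots,c_n)$ be vectors of positive integers, let $A_0(R,C)$ be the set of $m\times n$ matrices with entries in $\{0,1\}$, row sums $r_1,\dots,r_m$ and column sums $c_1,\dots,c_n$, and let $$F_0(x,y)=\Bigl(\prod_{i=1}^m x_i^{-r_i}\Bigr)\Bigl(\prod_{j=1}^n y_j^{-c_j}\Bigr)\prod_{i=1}^m\prod_{j=1}^n(1+x_iy_j),\qquad \alpha_0(R,C)=\inf_{\substack{x_1,\dots,x_m>0\\ y_1,\dots,y_n>0}}F_0(x,y).$$ Then $$\alpha_0(R,C)\ \ge\ |A_0(R,C)|\ \ge\ \lambda(R,C)\,\alpha_0(R,C),\qquad \lambda(R,C)=\frac{(mn)!}{(mn)^{mn}}\Bigl(\prod_{i=1}^m\frac{(n-r_i)^{n-r_i}}{(n-r_i)!}\Bigr)\Bigl(\prod_{j=1}^n\frac{c_j^{c_j}}{c_j!}\Bigr),$$ where $0^0=1$ and where the factor with index $i$ in the first product is read as $1$ if $r_i>n$. Moreover, there is an absolute constant $\gamma>0$ such that, for all $m$, $n$ and all such $R$, $C$, $$\alpha_0(R,C)\ \le\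 (mn)^{\gamma(m+n)}\,|A_0(R,C)|,$$ and, if in addition $r_1+\dots+r_m=c_1+\dots+c_n$ and $r_i\le n$ for all $i$, the ratio $1/\lambda(R,C)$ of the upper and the lower bound satisfies $1/\lambda(R,C)\le(mn)^{\gamma(m+n)}$. -/

import Mathlib

open scoped Nat

noncomputable section

/-- The set of all `m × n` matrices with entries in `{0, 1}`, row sums `r` and column sums `c`. -/
def A0 {m n : ℕ} (r : Fin m → ℕ) (c : Fin n → ℕ) : Set (Matrix (Fin m) (Fin n) ℕ) :=
  {D | (∀ i, ∑ j, D i j = r i) ∧ (∀ j, ∑ i, D i j = c j) ∧ ∀ i j, D i j = 0 ∨ D i j = 1}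

/-- The set is finite, so that its `Set.ncard` is its genuine cardinality. -/
theorem A0_finite {m n : ℕ} (r : Fin m → ℕ) (c : Fin n → ℕ) : (A0 r c).Finite := by
  have h : (Set.univ.pi fun _ : Fin m => Set.univ.pi fun _ : Fin n => ({0, 1} : Set ℕ)).Finite :=
    Set.Finite.pi fun _ => Set.Finite.pi fun _ => Set.toFinite _
  refine Set.Finite.subset h ?_
  intro D hD i _ j _
  exact hD.2.2 i j

/-- `F₀(x, y) = ∏ᵢ xᵢ^(-rᵢ) · ∏ⱼ yⱼ^(-cⱼ) · ∏ᵢⱼ (1 + xᵢ yⱼ)`. -/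
def F0 {m n : ℕ} (r : Fin m → ℕ) (c : Fin n → ℕ) (x : Fin m → ℝ) (y : Fin n → ℝ) : ℝ :=
  (∏ i, x i ^ (-(r i : ℤ))) * (∏ j, y j ^ (-(c j : ℤ))) * ∏ i, ∏ j, (1 + x i * y j)

/-- The set of values of `F₀` at the points with positive coordinates. -/
def F0Values {m n : ℕ} (r : Fin m → ℕ) (c : Fin n → ℕ) : Set ℝ :=
  {v | ∃ (x : Fin m → ℝ) (y : Fin n → ℝ), (∀ i, 0 < x i) ∧ (∀ j, 0 < y j) ∧ v = F0 r c x y}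

/-- `α₀(R, C)`, the infimum of `F₀` over positive `x` and `y`. -/
def alpha0 {m n : ℕ} (r : Fin m → ℕ) (c : Fin n → ℕ) : ℝ :=
  sInf (F0Values r c)

/-- The infimum is a genuine one: the set of values is non-empty and bounded below by `0`. -/
theorem isGLB_alpha0 {m n : ℕ} (r : Fin m → ℕ) (c : Fin n → ℕ) :
    IsGLB (F0Values r c) (alpha0 r c) := by
  refine isGLB_csInf ⟨_, fun _ => 1, fun _ => 1, by simp, by simp, rfl⟩ ⟨0, ?_⟩
  rintro v ⟨x, y, hx, hy, rfl⟩
  refine mul_nonneg (mul_nonneg ?_ ?_) ?_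
  · exact Finset.prod_nonneg fun i _ => (zpow_pos (hx i) _).le
  · exact Finset.prod_nonneg fun j _ => (zpow_pos (hy j) _).le
  · exact Finset.prod_nonneg fun i _ => Finset.prod_nonneg fun j _ =>
      add_nonneg zero_le_one (mul_pos (hx i) (hy j)).le

/-- The factor `(mn)!/(mn)^(mn) · ∏ᵢ (n-rᵢ)^(n-rᵢ)/(n-rᵢ)! · ∏ⱼ cⱼ^cⱼ/cⱼ!`, with `0 ^ 0 = 1`.
The `i`-th factor of the first product is only meaningful for `rᵢ ≤ n`. Subtraction is that of `ℕ`,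
so for `rᵢ > n` this factor is `1`. -/
def lowerFactor {m n : ℕ} (r : Fin m → ℕ) (c : Fin n → ℕ) : ℝ :=
  ((m * n)! : ℝ) / ((m * n : ℕ) : ℝ) ^ (m * n) *
    (∏ i, ((n - r i : ℕ) : ℝ) ^ (n - r i) / ((n - r i)! : ℝ)) *
    (∏ j, (c j : ℝ) ^ (c j) / ((c j)! : ℝ))

end

/-! The upper bound holds because every matrix in `A0 r c` contributes the monomial $x^r y^c$ to the
expansion of $\prod_{i,j}(1+x_iy_j)$, whose other terms are nonnegative.

The lower bound is Gurvits' capacity method. Substituting $x_i=1/w_i$ turns `F0` into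
$\prod_{i,j}(w_i+y_j)$ divided by $w^{n-r}y^c$, so `alpha0` is the capacity of this form at the
monomial whose coefficient counts `A0 r c`. The form is stable, and Gauss–Lucas shows that
differentiation in a positive direction preserves stability (`IsStableForm.dirDeriv`). A stable form
is real-rooted along positive lines, so each derivative costs the capacity only an explicit factor;
these telescope to $N!/N^N$ (`IsStableForm.capacity_le`). Differentiating $\alpha_i$ times in each
coordinate direction isolates the coefficient (`IsStableForm.le_coeff`).

If the margins have unequal totals or some $r_i>n$, then `alpha0` vanishes. Otherwise a
Stirling-type estimate bounds $1/\lambda$. -/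

noncomputable section

/-! ### Stable forms and their directional derivatives -/

open MvPolynomial in
/-- The derivative of `q` in the direction `b`. -/
def dirDeriv {σ : Type*} [Fintype σ] (b : σ → ℝ) (q : MvPolynomial σ ℝ) : MvPolynomial σ ℝ :=
  ∑ i, C (b i) * pderiv i q

/-- A homogeneous polynomial with nonnegative coefficients which does not vanish on the
product of open upper half-planes. -/
structure IsStableForm {σ : Type*} (d : ℕ) (q : MvPolynomial σ ℝ) : Prop where
  homogeneous : q.IsHomogeneous d
  coeff_nonneg : ∀ s, 0 ≤ q.coeff s
  stable : ∀ z : σ → ℂ, (∀ i, 0 < (z i).im) → MvPolynomial.aeval z q ≠ 0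

namespace MvPolynomial

theorem IsHomogeneous.aeval_mul_left {σ A : Type*} [CommRing A] [Algebra ℝ A]
    {q : MvPolynomial σ ℝ} {d : ℕ} (hq : q.IsHomogeneous d) (t : A) (z : σ → A) :
    MvPolynomial.aeval (fun i => t * z i) q = t ^ d * MvPolynomial.aeval z q := by
  rw [aeval_def, aeval_def, MvPolynomial.eval₂_eq, MvPolynomial.eval₂_eq, Finset.mul_sum]
  refine Finset.sum_congr rfl fun s hs => ?_
  have := hq.degree_eq_sum_deg_support hs
  simp_rw [mul_pow, Finset.prod_mul_distrib, Finset.prod_pow_eq_pow_sum]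
  rw [this]
  ring

theorem aeval_ofReal {σ : Type*} (x : σ → ℝ) (q : MvPolynomial σ ℝ) :
    aeval (fun i => (x i : ℂ)) q = (eval x q : ℂ) := by
  have := aeval_algebraMap_apply ℂ x q
  rwa [Complex.coe_algebraMap, Function.comp_def] at this

section Line

variable {σ K : Type*} [Field K] [Algebra ℝ K]

/-- The restriction of `q` to the line through `z` with direction `b`. -/
def onLine (z : σ → K) (b : σ → ℝ) (q : MvPolynomial σ ℝ) : Polynomial K :=
  aeval (fun i => Polynomial.C (z i) + Polynomial.C (algebraMap ℝ K (b i)) * Polynomial.X) q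

theorem eval_onLine (z : σ → K) (b : σ → ℝ) (q : MvPolynomial σ ℝ) (s : K) :
    (onLine z b q).eval s = aeval (fun i => z i + algebraMap ℝ K (b i) * s) q := by
  unfold onLine
  induction q using MvPolynomial.induction_on with
  | C a => simp [Polynomial.algebraMap_apply]
  | add p q hp hq => simp only [map_add, Polynomial.eval_add, hp, hq]
  | mul_X p i hp => simp only [map_mul, Polynomial.eval_mul, hp]; simp

theorem derivative_onLine [Fintype σ] (z : σ → K) (b : σ → ℝ) (q : MvPolynomial σ ℝ) :
    (onLine z b q).derivative = onLine z b (dirDeriv b q) := by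
  classical
  unfold onLine dirDeriv
  induction q using MvPolynomial.induction_on with
  | C a => simp [Polynomial.algebraMap_apply]
  | add p q hp hq =>
    simp only [map_add, mul_add, Finset.sum_add_distrib, hp, hq]
  | mul_X p i hp =>
    simp only [map_mul, Polynomial.derivative_mul, hp, Derivation.leibniz, map_sum, smul_eq_mul,
      map_add, mul_add, Finset.sum_add_distrib]
    simp [pderiv_X, Pi.single_apply, Polynomial.algebraMap_apply, Finset.sum_mul]
    rw [add_comm]
    congr 1
    · ring
    · refine Finset.sum_congr rfl fun _ _ => by ring

theorem natDegree_onLine_le (z : σ → ℝ) (b : σ → ℝ) {q : MvPolynomial σ ℝ} {d : ℕ}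
    (hq : q.totalDegree ≤ d) : (onLine z b q).natDegree ≤ d := by
  have := aeval_natDegree_le q hq
    (fun i => Polynomial.C (z i) + Polynomial.C (algebraMap ℝ ℝ (b i)) * Polynomial.X)
    (n := 1) (fun i => by
      rw [add_comm]
      exact Polynomial.natDegree_linear_le)
  simpa [onLine] using this

end Line

end MvPolynomial

open MvPolynomial

namespace IsStableForm

variable {σ : Type*} {d : ℕ} {q : MvPolynomial σ ℝ}

theorem eval_nonneg (hq : IsStableForm d q) {x : σ → ℝ} (hx : ∀ i, 0 ≤ x i) :
    0 ≤ eval x q := by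
  rw [eval_eq]
  exact Finset.sum_nonneg fun s _ => mul_nonneg (hq.coeff_nonneg s)
    (Finset.prod_nonneg fun i _ => pow_nonneg (hx i) _)

/-- By homogeneity $q(\mathrm{i}x)=\mathrm{i}^d q(x)$, and $\mathrm{i}x$ lies in the product of
upper half-planes. -/
theorem eval_pos (hq : IsStableForm d q) {x : σ → ℝ} (hx : ∀ i, 0 < x i) : 0 < eval x q := by
  refine lt_of_le_of_ne (hq.eval_nonneg fun i => (hx i).le) fun h => ?_
  refine hq.stable (fun i => Complex.I * (x i : ℂ)) (fun i => by simpa using hx i) ?_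
  rw [hq.homogeneous.aeval_mul_left, aeval_ofReal]
  simp [← h]

/-- On the line $s\mapsto z+sb$ the zeros of $q$ have $\operatorname{Im}s<0$. By Gauss–Lucas so do
those of the derivative, which therefore does not vanish at $s=0$. -/
theorem dirDeriv [Fintype σ] (hq : IsStableForm (d + 1) q) {b : σ → ℝ} (hb : ∀ i, 0 < b i) :
    IsStableForm d (dirDeriv b q) where
  homogeneous := by
    refine IsHomogeneous.sum _ _ _ fun i _ => ?_
    simpa using (hq.homogeneous.pderiv (i := i)).C_mul (b i)
  coeff_nonneg s := by
    unfold _root_.dirDeriv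
    rw [coeff_sum]
    refine Finset.sum_nonneg fun i _ => ?_
    rw [coeff_C_mul, coeff_pderiv]
    have := hq.coeff_nonneg (s + Finsupp.single i 1)
    have := (hb i).le
    positivity
  stable z hz h := by
    set f : Polynomial ℂ := onLine z b q with hf
    have hf' : f.derivative.eval 0 = 0 := by
      rw [hf, derivative_onLine, eval_onLine]
      simpa using h
    have hroot : ∀ s, f.eval s = 0 → s.im < 0 := by
      intro s hs
      by_contra! h0
      rw [hf, eval_onLine] at hs
      refine hq.stable _ (fun i => ?_) hs
      have := mul_nonneg (hb i).le h0
      simp only [Complex.coe_algebraMap, Complex.add_im, Complex.mul_im, Complex.ofReal_re,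
        Complex.ofReal_im, zero_mul, add_zero]
      linarith [hz i]
    -- Gauss–Lucas needs a nonconstant $f$. Were $f$ constant, homogeneity would give
    -- $q(tz+b)=t^{d+1}q(z)$ for $t>0$, and $t\to0$ would force $q(b)=0$, against positivity.
    have hdeg : 0 < f.degree := by
      by_contra! hdeg
      have hconst := Polynomial.eq_C_of_degree_le_zero hdeg
      have key : ∀ t : ℝ, 0 < t →
          aeval (fun i => (t : ℂ) * z i + b i) q = (t : ℂ) ^ (d + 1) * aeval z q := by
        intro t ht
        have ht' : (t : ℂ) ≠ 0 := by exact_mod_cast ht.ne'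
        have h1 : f.eval ((t : ℂ)⁻¹) = f.eval 0 := by rw [hconst]; simp
        rw [hf, eval_onLine, eval_onLine] at h1
        simp only [mul_zero, add_zero] at h1
        rw [← h1, ← hq.homogeneous.aeval_mul_left]
        congr 2
        funext i
        simp
        field_simp
      have hcont : Continuous fun t : ℝ => aeval (fun i => (t : ℂ) * z i + b i) q := by
        simp_rw [aeval_def, eval₂_eq]
        fun_prop
      have h1 := (hcont.tendsto 0).mono_left (nhdsWithin_le_nhds (s := Set.Ioi (0:ℝ)))
      have h2 : Filter.Tendsto (fun t : ℝ => (t : ℂ) ^ (d + 1) * aeval z q)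
          (nhdsWithin 0 (Set.Ioi 0)) (nhds 0) := by
        have : Continuous fun t : ℝ => (t : ℂ) ^ (d + 1) * aeval z q := by fun_prop
        simpa using (this.tendsto 0).mono_left (nhdsWithin_le_nhds (s := Set.Ioi (0:ℝ)))
      have h3 := tendsto_nhds_unique (h1.congr' (by
        filter_upwards [self_mem_nhdsWithin] with t ht using key t ht)) h2
      have h4 := hq.eval_pos hb
      have h5 : aeval (fun i => (b i : ℂ)) q = 0 := by simpa using h3
      rw [aeval_ofReal] at h5
      exact h4.ne' (by exact_mod_cast h5)
    have hne : f.derivative ≠ 0 := by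
      intro h0
      have := Polynomial.derivative_eq_zero.1 h0
      exact (Polynomial.natDegree_pos_iff_degree_pos.2 hdeg).ne' this
    have hmem : (0 : ℂ) ∈ convexHull ℝ (f.rootSet ℂ) :=
      Polynomial.rootSet_derivative_subset_convexHull_rootSet hdeg
        ((Polynomial.mem_rootSet).2 ⟨hne, by simpa using hf'⟩)
    have hsub : convexHull ℝ (f.rootSet ℂ) ⊆ {s : ℂ | s.im < 0} := by
      refine convexHull_min (fun s hs => hroot s ?_) (convex_halfSpace_im_lt 0)
      simpa using (Polynomial.mem_rootSet.1 hs).2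
    simpa using hsub hmem

end IsStableForm

/-! ### The arithmetic-geometric mean inequality and real-rooted polynomials -/

/-- The inequality between the arithmetic and geometric means, without roots. -/
theorem Finset.card_pow_mul_prod_le_sum_pow {ι : Type*} (s : Finset ι) (z : ι → ℝ)
    (hz : ∀ i ∈ s, 0 ≤ z i) : (s.card : ℝ) ^ s.card * ∏ i ∈ s, z i ≤ (∑ i ∈ s, z i) ^ s.card := by
  rcases s.eq_empty_or_nonempty with rfl | hs
  · simp
  have hc : (0 : ℝ) < s.card := by exact_mod_cast hs.card_pos
  have h := Real.geom_mean_le_arith_mean s (fun _ => 1) z (by simp) (by simpa using hc) hz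
  simp only [Real.rpow_one, one_mul, Finset.sum_const, nsmul_eq_mul, mul_one] at h
  have hp : 0 ≤ ∏ i ∈ s, z i := Finset.prod_nonneg hz
  have h2 := pow_le_pow_left₀ (Real.rpow_nonneg hp _) h s.card
  rw [← Real.rpow_natCast, ← Real.rpow_mul hp, inv_mul_cancel₀ hc.ne', Real.rpow_one, div_pow,
    le_div_iff₀ (by positivity)] at h2
  linarith

theorem Multiset.card_pow_mul_prod_le_sum_pow (s : Multiset ℝ) (hs : ∀ a ∈ s, 0 ≤ a) :
    (s.card : ℝ) ^ s.card * s.prod ≤ s.sum ^ s.card := by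
  induction s using Quot.inductionOn with
  | _ l =>
    have := Finset.card_pow_mul_prod_le_sum_pow (Finset.univ : Finset (Fin l.length)) l.get
      (fun i _ => hs _ (by simp))
    simpa [Fin.prod_univ_getElem, Fin.sum_univ_getElem] using this

theorem Multiset.prod_one_add_le (s : Multiset ℝ) (hs : ∀ a ∈ s, 0 ≤ a) {d : ℕ}
    (hd : s.card ≤ d) (hd0 : 0 < d) : (s.map (1 + ·)).prod ≤ (1 + s.sum / d) ^ d := by
  -- Padding with ones gives exactly $d$ factors.
  have h := Multiset.card_pow_mul_prod_le_sum_pow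
    (s.map (1 + ·) + Multiset.replicate (d - s.card) 1) (by
      intro a ha
      rcases Multiset.mem_add.1 ha with ha | ha
      · obtain ⟨b, hb, rfl⟩ := Multiset.mem_map.1 ha
        have := hs b hb
        positivity
      · rw [Multiset.eq_of_mem_replicate ha]
        exact zero_le_one)
  have hd' : (0 : ℝ) < d := by exact_mod_cast hd0
  have hc : s.card + (d - s.card) = d := by omega
  have hsum : (s.map (1 + ·)).sum + (d - s.card : ℕ) = d + s.sum := by
    have : (s.map (1 + ·)).sum = s.card + s.sum := by
      simpa using Multiset.sum_map_add (m := s) (f := fun _ => (1 : ℝ)) (g := fun x => x)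
    rw [this, Nat.cast_sub hd]
    ring
  simp only [Multiset.card_add, Multiset.card_map, Multiset.card_replicate, hc, Multiset.prod_add,
    Multiset.prod_replicate, one_pow, mul_one, Multiset.sum_add, Multiset.sum_replicate,
    nsmul_eq_mul, hsum] at h
  have h2 : (1 + s.sum / d) ^ d = (d + s.sum) ^ d / (d : ℝ) ^ d := by
    rw [← div_pow]
    congr 1
    field_simp
  rw [h2, le_div_iff₀ (by positivity)]
  linarith

open Polynomial in
/-- A lower bound on the linear coefficient of a real-rooted polynomial. -/
theorem Polynomial.le_eval_derivative_of_real_rooted {f : ℝ[X]} {n : ℕ} (hn : 0 < n)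
    (hdeg : f.natDegree ≤ n + 1) (hroot : ∀ s : ℂ, aeval s f = 0 → s.im = 0)
    (hpos : ∀ t, 0 ≤ t → 0 < f.eval t) {κ : ℝ} (hκ : ∀ t, 0 < t → κ * t ≤ f.eval t) :
    κ * ((n : ℝ) / (n + 1)) ^ n ≤ f.derivative.eval 0 := by
  have hf0 : f ≠ 0 := by
    rintro rfl
    simpa using hpos 0 le_rfl
  have hsplit : f.Splits := by
    refine Splits.of_splits_map (algebraMap ℝ ℂ) (IsAlgClosed.splits _) fun a ha => ?_
    have := hroot a (by simpa [eval_map_algebraMap] using isRoot_of_mem_roots ha)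
    exact ⟨a.re, Complex.ext rfl (by simp [this])⟩
  have hneg : ∀ z ∈ f.roots, z < 0 := by
    intro z hz
    by_contra! h
    exact (hpos z h).ne' (isRoot_of_mem_roots hz)
  set a : Multiset ℝ := f.roots.map fun z => 1 / (0 - z) with ha
  have ha0 : ∀ x ∈ a, 0 ≤ x := by
    intro x hx
    obtain ⟨z, hz, rfl⟩ := Multiset.mem_map.1 hx
    have := hneg z hz
    exact (one_div_pos.2 (by linarith)).le
  have hcard : a.card ≤ n + 1 := by
    rw [ha, Multiset.card_map]
    exact (card_roots' f).trans hdeg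
  have hder : f.derivative.eval 0 = f.eval 0 * a.sum :=
    hsplit.eval_derivative_eq_eval_mul_sum (hpos 0 le_rfl).ne'
  -- With $a=-1/z$ over the roots, $f(t)=f(0)\prod(1+ta)$, so AM-GM bounds $f$ by a perfect power
  -- with the same value and slope at $0$.
  have hle : ∀ t, 0 < t → f.eval t ≤ f.eval 0 * (1 + t * a.sum / (n + 1)) ^ (n + 1) := by
    intro t ht
    have h1 : f.eval t = f.eval 0 * ((a.map (t * ·)).map (1 + ·)).prod := by
      rw [hsplit.eval_eq_prod_roots, hsplit.eval_eq_prod_roots, mul_assoc, ha, Multiset.map_map,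
        Multiset.map_map, ← Multiset.prod_map_mul]
      congr 2
      refine Multiset.map_congr rfl fun z hz => ?_
      have := (hneg z hz).ne
      simp only [Function.comp_apply]
      field_simp
      ring
    rw [h1]
    refine mul_le_mul_of_nonneg_left ?_ (hpos 0 le_rfl).le
    have := Multiset.prod_one_add_le (a.map (t * ·)) (by
      intro x hx
      obtain ⟨z, hz, rfl⟩ := Multiset.mem_map.1 hx
      exact mul_nonneg ht.le (ha0 z hz)) (d := n + 1) (by simpa using hcard) (by omega)
    have hs : (a.map (t * ·)).sum = t * a.sum := by
      simpa using Multiset.sum_map_mul_left (s := a) (a := t) (f := fun x => x)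
    rw [hs] at this
    simpa using this
  have hA := hpos 0 le_rfl
  have hn' : (0 : ℝ) < n := by exact_mod_cast hn
  rw [hder]
  rcases (Multiset.sum_nonneg ha0).eq_or_lt with hS | hS
  -- Here $f(t)\le f(0)$ for $t>0$, so a linear lower bound cannot have positive slope.
  · have hκ0 : κ ≤ 0 := by
      by_contra! hκ0
      have ht : 0 < (f.eval 0 + 1) / κ := by positivity
      have h1 := (hκ _ ht).trans (hle _ ht)
      rw [← hS, mul_div_cancel₀ _ hκ0.ne'] at h1
      simp at h1
      linarith
    rw [← hS, mul_zero]
    exact mul_nonpos_of_nonpos_of_nonneg hκ0 (by positivity)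
  -- This $t$ minimises $(1+tS/(n+1))^{n+1}/t$, where $S$ is `a.sum`.
  · have ht : 0 < (n + 1) / (n * a.sum) := by positivity
    have h1 := (hκ _ ht).trans (hle _ ht)
    have h2 : 1 + (n + 1) / (n * a.sum) * a.sum / (n + 1) = ((n : ℝ) + 1) / n := by
      field_simp
    rw [h2] at h1
    have h3 : (0 : ℝ) < (n / (n + 1)) ^ n * (n * a.sum / (n + 1)) := by positivity
    have h4 := mul_le_mul_of_nonneg_right h1 h3.le
    calc κ * ((n : ℝ) / (n + 1)) ^ n
        = κ * ((n + 1) / (n * a.sum)) * ((n / (n + 1)) ^ n * (n * a.sum / (n + 1))) := by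
          field_simp
      _ ≤ _ := h4
      _ = f.eval 0 * a.sum := by
          rw [pow_succ, div_pow, div_pow]
          field_simp

/-! ### The capacity inequality -/

namespace IsStableForm

variable {σ : Type*} [Fintype σ] {d : ℕ} {q : MvPolynomial σ ℝ}

theorem le_eval_dirDeriv (hq : IsStableForm (d + 1) q) (hd : 0 < d) {v b : σ → ℝ}
    (hv : ∀ i, 0 < v i) (hb : ∀ i, 0 < b i) {κ : ℝ}
    (hκ : ∀ t, 0 < t → κ * t ≤ eval (fun i => v i + b i * t) q) :
    κ * ((d : ℝ) / (d + 1)) ^ d ≤ eval v (_root_.dirDeriv b q) := by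
  have hev : ∀ t, (onLine v b q).eval t = eval (fun i => v i + b i * t) q := by
    intro t
    rw [eval_onLine, ← aeval_eq_eval]
    rfl
  have h := Polynomial.le_eval_derivative_of_real_rooted (f := onLine v b q) hd
    (natDegree_onLine_le v b hq.homogeneous.totalDegree_le) ?_ ?_ (κ := κ) ?_
  · rw [derivative_onLine, eval_onLine] at h
    simpa [aeval_eq_eval] using h
  · have himp : ∀ s : ℂ, Polynomial.aeval s (onLine v b q) = 0 → s.im ≤ 0 := by
      intro s hs
      by_contra! h0
      refine hq.stable (fun i => (v i : ℂ) + b i * s) (fun i => by simpa using mul_pos (hb i) h0) ?_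
      rw [← hs, onLine, ← AlgHom.comp_apply]
      congr 1
      ext i
      simp
    intro s hs
    refine le_antisymm (himp s hs) ?_
    have := himp (starRingEnd ℂ s) (by
      rw [Polynomial.aeval_conj, hs, map_zero])
    simpa using this
  · intro t ht
    rw [hev]
    exact hq.eval_pos fun i => add_pos_of_pos_of_nonneg (hv i) (mul_nonneg (hb i).le ht)
  · intro t ht
    rw [hev]
    exact hκ t ht

/-- Euler's identity for a linear form. It replaces the real-rooted bound, which needs $d>0$, at the
last derivative. -/
theorem eval_zero_dirDeriv (hq : IsStableForm 1 q) (b : σ → ℝ) :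
    eval 0 (_root_.dirDeriv b q) = eval b q := by
  have h := congrArg (eval b) hq.homogeneous.sum_X_mul_pderiv
  rw [one_smul] at h
  rw [← h, _root_.dirDeriv, map_sum, map_sum]
  refine Finset.sum_congr rfl fun i _ => ?_
  have h0 := hq.homogeneous.pderiv (i := i)
  rw [← totalDegree_zero_iff_isHomogeneous, totalDegree_eq_zero_iff_eq_C] at h0
  rw [h0]
  simp

end IsStableForm

/-- The iterated derivative in the directions `b 0, …, b (N - 1)`. -/
def iterDirDeriv {σ : Type*} [Fintype σ] :
    (N : ℕ) → (Fin N → σ → ℝ) → MvPolynomial σ ℝ → MvPolynomial σ ℝ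
  | 0, _, q => q
  | N + 1, b, q => iterDirDeriv N (Fin.tail b) (dirDeriv (b 0) q)

/-- **Gurvits' capacity inequality** for stable forms. -/
theorem IsStableForm.capacity_le {σ : Type*} [Fintype σ] {N : ℕ} {b : Fin N → σ → ℝ}
    (hb : ∀ k i, 0 < b k i) {q : MvPolynomial σ ℝ} (hq : IsStableForm N q) {κ : ℝ}
    (hκ : ∀ x : Fin N → ℝ, (∀ k, 0 < x k) →
      κ * ∏ k, x k ≤ eval (fun i => ∑ k, b k i * x k) q) :
    κ * ((N ! : ℝ) / (N : ℝ) ^ N) ≤ eval 0 (iterDirDeriv N b q) := by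
  induction N generalizing q κ with
  | zero => simpa [iterDirDeriv, Pi.zero_def] using hκ 0 (fun k => k.elim0)
  | succ N ih =>
    rw [iterDirDeriv]
    rcases N.eq_zero_or_pos with rfl | hN
    · have h := hκ 1 (by simp)
      simp only [iterDirDeriv]
      rw [hq.eval_zero_dirDeriv]
      simpa using h
    · have hN' : (0 : ℝ) < N := by exact_mod_cast hN
      -- The loss telescopes: $(N+1)!/(N+1)^{N+1}=(N/(N+1))^N\cdot N!/N^N$.
      have h := ih (b := Fin.tail b) (fun k i => hb _ i) (hq.dirDeriv (hb 0))
        (κ := κ * ((N : ℝ) / (N + 1)) ^ N) ?_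
      · refine le_of_eq_of_le ?_ h
        rw [Nat.factorial_succ, div_pow]
        push_cast
        field_simp
        ring
      · intro x hx
        have hne : (Finset.univ : Finset (Fin N)).Nonempty := ⟨⟨0, hN⟩, Finset.mem_univ _⟩
        have h2 := hq.le_eval_dirDeriv hN (v := fun i => ∑ k, Fin.tail b k i * x k) (b := b 0)
          (fun i => Finset.sum_pos (fun k _ => mul_pos (hb _ i) (hx k)) hne) (hb 0)
          (κ := κ * ∏ k, x k) (by
            intro t ht
            have := hκ (Fin.cons t x) (fun k => by
              refine Fin.cases ?_ ?_ k
              · simpa using ht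
              · simpa using hx)
            simp only [Fin.prod_univ_succ, Fin.sum_univ_succ, Fin.cons_zero, Fin.cons_succ] at this
            simp only [Fin.tail]
            calc κ * (∏ k, x k) * t = κ * (t * ∏ k, x k) := by ring
              _ ≤ _ := this
              _ = _ := by simp only [add_comm])
        linarith

/-! ### From iterated derivatives to coefficients -/

theorem dirDeriv_single {σ : Type*} [Fintype σ] [DecidableEq σ] (i : σ) (q : MvPolynomial σ ℝ) :
    dirDeriv (Pi.single i 1) q = pderiv i q := by
  rw [dirDeriv, Finset.sum_eq_single i]
  · simp
  · intro j _ hj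
    simp [hj]
  · simp

/-- Only $t=0$ is used later, where the constant term of the derivative is $\alpha!$ times the
coefficient at $\alpha$; general $t$ makes the induction work. -/
theorem coeff_iterDirDeriv_single {σ : Type*} [Fintype σ] [DecidableEq σ] {N : ℕ}
    (k : Fin N → σ) (q : MvPolynomial σ ℝ) (t : σ →₀ ℕ) :
    (∏ i, ((t i)! : ℝ)) * coeff t (iterDirDeriv N (fun j => Pi.single (k j) 1) q) =
      (∏ i, (((t + ∑ j, Finsupp.single (k j) 1 : σ →₀ ℕ) i)! : ℝ)) *
        coeff (t + ∑ j, Finsupp.single (k j) 1) q := by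
  induction N generalizing q with
  | zero => simp [iterDirDeriv]
  | succ N ih =>
    have h : Fin.tail (fun j => (Pi.single (k j) 1 : σ → ℝ)) =
        fun j => Pi.single (Fin.tail k j) 1 := rfl
    rw [iterDirDeriv, h, ih, dirDeriv_single, coeff_pderiv, Fin.sum_univ_succ]
    simp only [Fin.tail]
    set u : σ →₀ ℕ := t + ∑ j : Fin N, Finsupp.single (k j.succ) 1 with hu
    have hadd : t + (Finsupp.single (k 0) 1 + ∑ j : Fin N, Finsupp.single (k j.succ) 1) =
        u + Finsupp.single (k 0) 1 := by
      rw [hu]; abel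
    rw [hadd]
    have hfac : ∏ i, (((u + Finsupp.single (k 0) 1 : σ →₀ ℕ) i)! : ℝ) =
        (∏ i, ((u i)! : ℝ)) * (u (k 0) + 1) := by
      rw [← Finset.mul_prod_erase _ _ (Finset.mem_univ (k 0)),
        ← Finset.mul_prod_erase _ (fun i => ((u i)! : ℝ)) (Finset.mem_univ (k 0))]
      have : ∏ i ∈ Finset.univ.erase (k 0), (((u + Finsupp.single (k 0) 1 : σ →₀ ℕ) i)! : ℝ) =
          ∏ i ∈ Finset.univ.erase (k 0), ((u i)! : ℝ) := by
        refine Finset.prod_congr rfl fun i hi => ?_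
        rw [Finsupp.add_apply, Finsupp.single_eq_of_ne (Finset.ne_of_mem_erase hi), add_zero]
      rw [this, Finsupp.add_apply, Finsupp.single_eq_same, Nat.factorial_succ]
      push_cast
      ring
    rw [hfac]
    ring

theorem continuous_coeff_iterDirDeriv {σ : Type*} [Fintype σ] {N : ℕ} {b : ℝ → Fin N → σ → ℝ}
    (hb : ∀ k i, Continuous fun ε => b ε k i) {q : ℝ → MvPolynomial σ ℝ}
    (hq : ∀ s, Continuous fun ε => coeff s (q ε)) (s : σ →₀ ℕ) :
    Continuous fun ε => coeff s (iterDirDeriv N (b ε) (q ε)) := by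
  induction N generalizing q with
  | zero => exact hq s
  | succ N ih =>
    simp only [iterDirDeriv]
    refine ih (b := fun ε => Fin.tail (b ε)) (fun k i => hb _ i)
      (q := fun ε => dirDeriv (b ε 0) (q ε)) fun t => ?_
    simp only [dirDeriv, coeff_sum, coeff_C_mul, coeff_pderiv]
    exact continuous_finsetSum _ fun i _ => (hb 0 i).mul ((hq _).mul continuous_const)

/-- A lower bound on a coefficient of a stable form in terms of its capacity. -/
theorem IsStableForm.le_coeff {σ : Type*} [Fintype σ] {N : ℕ} {q : MvPolynomial σ ℝ}
    (hq : IsStableForm N q) (α : σ →₀ ℕ) (hα : ∑ i, α i = N) {κ : ℝ} (hκ0 : 0 ≤ κ)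
    (hκ : ∀ w : σ → ℝ, (∀ i, 0 < w i) → κ * ∏ i, w i ^ α i ≤ eval w q) :
    (N ! : ℝ) / (N : ℝ) ^ N * (∏ i, (α i : ℝ) ^ α i / ((α i)! : ℝ)) * κ ≤ coeff α q := by
  classical
  rcases N.eq_zero_or_pos with rfl | hN
  · have hz : ∀ i, α i = 0 := fun i => by
      have := Finset.sum_eq_zero_iff.1 hα i (Finset.mem_univ i)
      exact this
    have h0 := hq.homogeneous
    rw [← totalDegree_zero_iff_isHomogeneous, totalDegree_eq_zero_iff_eq_C] at h0
    have h1 := hκ 1 (by simp)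
    have hα0 : α = 0 := by ext i; simp [hz i]
    rw [h0] at h1
    simpa [hα0] using h1
  -- The $N$ directions consist of $\alpha_i$ copies of each coordinate vector.
  let e : Fin N ≃ Σ i, Fin (α i) := (Fintype.equivFinOfCardEq (by simpa using hα)).symm
  let k : Fin N → σ := fun j => (e j).1
  have hsum : ∑ j, Finsupp.single (k j) 1 = α := by
    ext i
    rw [Finsupp.finsetSum_apply, ← e.symm.sum_comp]
    simp only [k, Equiv.apply_symm_apply, Fintype.sum_sigma, Finsupp.single_apply]
    simp [apply_ite Finset.card]
  -- The capacity inequality needs strictly positive directions, so the coordinate vectors are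
  -- shifted by $\varepsilon$, and $\varepsilon\to0^+$ at the end.
  let b : ℝ → Fin N → σ → ℝ := fun ε j i => (Pi.single (k j) 1 : σ → ℝ) i + ε
  have hb0 : ∀ j i, 0 ≤ (Pi.single (k j) 1 : σ → ℝ) i := fun j i => by
    rw [Pi.single_apply]; split_ifs <;> simp
  have hpos : ∀ ε, 0 < ε → κ * (∏ i, (α i : ℝ) ^ α i) * ((N ! : ℝ) / (N : ℝ) ^ N) ≤
      coeff 0 (iterDirDeriv N (b ε) q) := by
    intro ε hε
    have h := hq.capacity_le (b := b ε) (fun j i => add_pos_of_nonneg_of_pos (hb0 j i) hε)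
      (κ := κ * ∏ i, (α i : ℝ) ^ α i) ?_
    · rwa [eval_zero, constantCoeff_eq] at h
    · intro x hx
      have hne : (Finset.univ : Finset (Fin N)).Nonempty := ⟨⟨0, hN⟩, Finset.mem_univ _⟩
      refine le_trans ?_ (hκ _ fun i => Finset.sum_pos (fun j _ =>
        mul_pos (add_pos_of_nonneg_of_pos (hb0 j i) hε) (hx j)) hne)
      rw [mul_assoc]
      refine mul_le_mul_of_nonneg_left ?_ hκ0
      rw [← e.symm.prod_comp, Fintype.prod_sigma, ← Finset.prod_mul_distrib]
      refine Finset.prod_le_prod (fun i _ => mul_nonneg (by positivity)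
        (Finset.prod_nonneg fun a _ => (hx _).le)) fun i _ => ?_
      -- AM-GM over the $\alpha_i$ copies of direction $i$ is the source of $\alpha_i^{\alpha_i}$.
      have hag := Finset.card_pow_mul_prod_le_sum_pow Finset.univ
        (fun a : Fin (α i) => x (e.symm ⟨i, a⟩)) fun a _ => (hx _).le
      rw [Finset.card_univ, Fintype.card_fin] at hag
      refine hag.trans (pow_le_pow_left₀ (Finset.sum_nonneg fun a _ => (hx _).le) ?_ _)
      calc ∑ a, x (e.symm ⟨i, a⟩) = ∑ j, (Pi.single (k j) 1 : σ → ℝ) i * x j := by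
            rw [← e.symm.sum_comp]
            simp only [k, Equiv.apply_symm_apply, Fintype.sum_sigma, Pi.single_apply]
            rw [Finset.sum_eq_single i]
            · simp
            · intro i' _ hi'
              simp [hi'.symm]
            · simp
        _ ≤ _ := Finset.sum_le_sum fun j _ =>
            mul_le_mul_of_nonneg_right (le_add_of_nonneg_right hε.le) (hx j).le
  have hcont : Continuous fun ε => coeff 0 (iterDirDeriv N (b ε) q) :=
    continuous_coeff_iterDirDeriv (q := fun _ => q)
      (fun j i => continuous_const.add continuous_id) (fun s => continuous_const) 0
  have hlim := ge_of_tendsto ((hcont.tendsto 0).mono_left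
    (nhdsWithin_le_nhds (s := Set.Ioi (0 : ℝ)))) (by
      filter_upwards [self_mem_nhdsWithin] with ε hε using hpos ε hε)
  have hfin := coeff_iterDirDeriv_single k q 0
  have hb00 : b 0 = fun j => Pi.single (k j) 1 := by
    funext j i
    simp [b]
  rw [hb00] at hlim
  simp only [zero_add, hsum, Finsupp.coe_zero, Pi.zero_apply, Nat.factorial_zero, Nat.cast_one,
    Finset.prod_const_one, one_mul] at hfin
  rw [hfin] at hlim
  have hf : (0 : ℝ) < ∏ i, ((α i)! : ℝ) :=
    Finset.prod_pos fun i _ => by exact_mod_cast (α i).factorial_pos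
  rw [Finset.prod_div_distrib]
  rw [← div_le_iff₀' hf] at hlim
  refine le_of_eq_of_le ?_ hlim
  ring

/-! ### The form whose coefficients count zero-one matrices -/

/-- The product of the linear forms `wᵢ + yⱼ`. -/
def bipartiteForm (m n : ℕ) : MvPolynomial (Fin m ⊕ Fin n) ℝ :=
  ∏ p : Fin m × Fin n, (X (Sum.inr p.2) + X (Sum.inl p.1))

theorem MvPolynomial.coeff_prod_nonneg {σ ι : Type*} (s : Finset ι) (f : ι → MvPolynomial σ ℝ)
    (hf : ∀ i ∈ s, ∀ t, 0 ≤ (f i).coeff t) (t : σ →₀ ℕ) : 0 ≤ (∏ i ∈ s, f i).coeff t := by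
  classical
  induction s using Finset.induction_on generalizing t with
  | empty =>
    rw [Finset.prod_empty, coeff_one]
    split_ifs <;> simp
  | insert a s ha ih =>
    rw [Finset.prod_insert ha, coeff_mul]
    exact Finset.sum_nonneg fun p _ => mul_nonneg (hf a (Finset.mem_insert_self a s) _)
      (ih (fun i hi => hf i (Finset.mem_insert_of_mem hi)) _)

theorem isStableForm_bipartiteForm (m n : ℕ) : IsStableForm (m * n) (bipartiteForm m n) where
  homogeneous := by
    have := IsHomogeneous.prod Finset.univ
      (fun p : Fin m × Fin n => (X (Sum.inr p.2) + X (Sum.inl p.1) :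
        MvPolynomial (Fin m ⊕ Fin n) ℝ)) (fun _ => 1)
      (fun p _ => (isHomogeneous_X _ _).add (isHomogeneous_X _ _))
    simpa [bipartiteForm] using this
  coeff_nonneg := by
    classical
    refine MvPolynomial.coeff_prod_nonneg _ _ fun p _ t => ?_
    rw [coeff_add, coeff_X, coeff_X]
    split_ifs <;> simp
  stable z hz := by
    rw [bipartiteForm, map_prod, Finset.prod_ne_zero_iff]
    intro p _ h
    have := congrArg Complex.im h
    simp only [map_add, aeval_X, Complex.add_im, Complex.zero_im] at this
    linarith [hz (Sum.inr p.2), hz (Sum.inl p.1)]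

/-- The exponents of the monomial of `bipartiteForm` which counts `A0 r c`. -/
def marginExponent {m n : ℕ} (r : Fin m → ℕ) (c : Fin n → ℕ) : Fin m ⊕ Fin n →₀ ℕ :=
  Finsupp.equivFunOnFinite.symm (Sum.elim (fun i => n - r i) c)

@[simp] theorem marginExponent_inl {m n : ℕ} (r : Fin m → ℕ) (c : Fin n → ℕ) (i : Fin m) :
    marginExponent r c (Sum.inl i) = n - r i := rfl

@[simp] theorem marginExponent_inr {m n : ℕ} (r : Fin m → ℕ) (c : Fin n → ℕ) (j : Fin n) :
    marginExponent r c (Sum.inr j) = c j := rfl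

theorem sum_marginExponent {m n : ℕ} {r : Fin m → ℕ} {c : Fin n → ℕ}
    (hrc : ∑ i, r i = ∑ j, c j) (hr : ∀ i, r i ≤ n) : ∑ s, marginExponent r c s = m * n := by
  rw [Fintype.sum_sum_type]
  simp only [marginExponent_inl, marginExponent_inr]
  rw [← hrc, ← Finset.sum_add_distrib]
  simp [Nat.sub_add_cancel (hr _)]

theorem sum_ite_mem_self {ι : Type*} [Fintype ι] [DecidableEq ι] (t : Finset ι) (f : ι → ℕ) :
    ∑ p, (if p ∈ t then f p else 0) = ∑ p ∈ t, f p := by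
  simp

/-- Each cell $(i,j)$ picks $y_j$ (entry 1) or $w_i$ (entry 0), so row $i$ has $n-r_i$ zeros.
Injectivity of the passage from cell sets to matrices suffices for this inequality. -/
theorem coeff_bipartiteForm_le {m n : ℕ} {r : Fin m → ℕ} {c : Fin n → ℕ} (hr : ∀ i, r i ≤ n) :
    (bipartiteForm m n).coeff (marginExponent r c) ≤ ((A0 r c).ncard : ℝ) := by
  classical
  let E : Finset (Fin m × Fin n) → (Fin m ⊕ Fin n →₀ ℕ) := fun t =>
    ∑ p ∈ t, Finsupp.single (Sum.inr p.2) 1 +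
      ∑ p ∈ Finset.univ \ t, Finsupp.single (Sum.inl p.1) 1
  have hcoeff : (bipartiteForm m n).coeff (marginExponent r c) =
      ((Finset.univ.filter fun t => E t = marginExponent r c).card : ℝ) := by
    rw [bipartiteForm, Finset.prod_add, coeff_sum, Finset.powerset_univ, Finset.card_filter]
    push_cast
    refine Finset.sum_congr rfl fun t _ => ?_
    rw [← coeff_monomial (m := marginExponent r c) (n := E t) (1 : ℝ)]
    congr 1
    simp only [E, X, ← monomial_sum_one, monomial_mul, mul_one]
  rw [hcoeff, Nat.cast_le, ← Set.ncard_coe_finset]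
  refine Set.ncard_le_ncard_of_injOn (fun t => fun i j => if (i, j) ∈ t then 1 else 0) ?_ ?_
    (A0_finite r c)
  · intro t ht
    have ht' : E t = marginExponent r c := by simpa using ht
    refine ⟨fun i => ?_, fun j => ?_, fun i j => ?_⟩
    · have h := DFunLike.congr_fun ht' (Sum.inl i)
      simp only [E, Finsupp.add_apply, Finsupp.finsetSum_apply, Finsupp.single_apply,
        marginExponent_inl, reduceCtorEq, if_false, Finset.sum_const_zero, zero_add,
        Sum.inl.injEq] at h
      have h2 : (∑ p ∈ Finset.univ \ t, if p.1 = i then 1 else 0) +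
          (∑ p ∈ t, if p.1 = i then 1 else 0) = n := by
        rw [Finset.sum_sdiff (Finset.subset_univ t), Fintype.sum_prod_type]
        simp [apply_ite Finset.card]
      have h3 : (∑ p ∈ t, if p.1 = i then 1 else 0) = ∑ j, if (i, j) ∈ t then 1 else 0 := by
        rw [← sum_ite_mem_self t, Fintype.sum_prod_type]
        rw [Finset.sum_eq_single i (fun k _ hk => by simp [hk]) (by simp)]
        simp
      have := hr i
      change ∑ j, (if (i, j) ∈ t then 1 else 0) = r i
      omega
    · have h := DFunLike.congr_fun ht' (Sum.inr j)
      simp only [E, Finsupp.add_apply, Finsupp.finsetSum_apply, Finsupp.single_apply,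
        marginExponent_inr, reduceCtorEq, if_false, Finset.sum_const_zero, add_zero,
        Sum.inr.injEq] at h
      rw [← h, ← sum_ite_mem_self t, Fintype.sum_prod_type_right]
      rw [Finset.sum_eq_single j (fun k _ hk => by simp [hk]) (by simp)]
      simp
    · by_cases h : (i, j) ∈ t <;> simp [h]
  · intro t _ u _ htu
    ext ⟨i, j⟩
    have := congrFun (congrFun htu i) j
    by_cases h1 : (i, j) ∈ t <;> by_cases h2 : (i, j) ∈ u <;> simp_all

/-! ### The two bounds by `alpha0` -/

theorem ncard_A0_le_F0 {m n : ℕ} (r : Fin m → ℕ) (c : Fin n → ℕ) {x : Fin m → ℝ} {y : Fin n → ℝ}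
    (hx : ∀ i, 0 < x i) (hy : ∀ j, 0 < y j) : ((A0 r c).ncard : ℝ) ≤ F0 r c x y := by
  classical
  have hfin := A0_finite r c
  let T : Matrix (Fin m) (Fin n) ℕ → Finset (Fin m × Fin n) := fun D =>
    Finset.univ.filter fun p => D p.1 p.2 = 1
  have hprod : ∀ D ∈ A0 r c, ∏ p ∈ T D, (x p.1 * y p.2) = (∏ i, x i ^ r i) * ∏ j, y j ^ c j := by
    rintro D ⟨h1, h2, h3⟩
    have h4 : ∏ p ∈ T D, (x p.1 * y p.2) = ∏ p : Fin m × Fin n, (x p.1 * y p.2) ^ D p.1 p.2 := by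
      rw [Finset.prod_filter]
      refine Finset.prod_congr rfl fun p _ => ?_
      rcases h3 p.1 p.2 with h | h <;> simp [h]
    rw [h4]
    simp_rw [mul_pow, Finset.prod_mul_distrib]
    congr 1
    · rw [Fintype.prod_prod_type]
      refine Finset.prod_congr rfl fun i _ => ?_
      change ∏ j, x i ^ D i j = _
      rw [Finset.prod_pow_eq_pow_sum, h1 i]
    · rw [Fintype.prod_prod_type_right]
      refine Finset.prod_congr rfl fun j _ => ?_
      change ∏ i, y j ^ D i j = _
      rw [Finset.prod_pow_eq_pow_sum, h2 j]
  have hinj : Set.InjOn T (A0 r c) := by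
    rintro D ⟨-, -, hD⟩ D' ⟨-, -, hD'⟩ h
    ext i j
    have h1 : D i j = 1 ↔ D' i j = 1 := by
      have := Finset.ext_iff.1 h (i, j)
      simpa [T] using this
    have := hD i j
    have := hD' i j
    omega
  have hM : 0 < (∏ i, x i ^ r i) * ∏ j, y j ^ c j :=
    mul_pos (Finset.prod_pos fun i _ => pow_pos (hx i) _)
      (Finset.prod_pos fun j _ => pow_pos (hy j) _)
  have hle : ((A0 r c).ncard : ℝ) * ((∏ i, x i ^ r i) * ∏ j, y j ^ c j) ≤
      ∏ i, ∏ j, (1 + x i * y j) := by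
    rw [← Fintype.prod_prod_type' fun i j => 1 + x i * y j, Finset.prod_one_add,
      Finset.powerset_univ]
    calc ((A0 r c).ncard : ℝ) * ((∏ i, x i ^ r i) * ∏ j, y j ^ c j)
        = ∑ t ∈ hfin.toFinset.image T, ∏ p ∈ t, (x p.1 * y p.2) := by
          rw [Finset.sum_image (by simpa using hinj), Set.ncard_eq_toFinset_card _ hfin,
            ← nsmul_eq_mul]
          exact (Finset.sum_eq_card_nsmul fun D hD => hprod D (by simpa using hD)).symm
      _ ≤ _ := Finset.sum_le_sum_of_subset_of_nonneg (Finset.subset_univ _) fun t _ _ =>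
          Finset.prod_nonneg fun p _ => (mul_pos (hx _) (hy _)).le
  rw [F0]
  simp only [zpow_neg, zpow_natCast, Finset.prod_inv_distrib]
  rw [← mul_inv, inv_mul_eq_div, le_div_iff₀ hM]
  exact hle

theorem ncard_A0_le_alpha0 {m n : ℕ} (r : Fin m → ℕ) (c : Fin n → ℕ) :
    ((A0 r c).ncard : ℝ) ≤ alpha0 r c := by
  refine (isGLB_alpha0 r c).2 ?_
  rintro v ⟨x, y, hx, hy, rfl⟩
  exact ncard_A0_le_F0 r c hx hy

theorem alpha0_nonneg {m n : ℕ} (r : Fin m → ℕ) (c : Fin n → ℕ) : 0 ≤ alpha0 r c :=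
  (Nat.cast_nonneg _).trans (ncard_A0_le_alpha0 r c)

theorem alpha0_le_F0 {m n : ℕ} (r : Fin m → ℕ) (c : Fin n → ℕ) {x : Fin m → ℝ} {y : Fin n → ℝ}
    (hx : ∀ i, 0 < x i) (hy : ∀ j, 0 < y j) : alpha0 r c ≤ F0 r c x y :=
  (isGLB_alpha0 r c).1 ⟨x, y, hx, hy, rfl⟩

theorem lowerFactor_eq {m n : ℕ} (r : Fin m → ℕ) (c : Fin n → ℕ) :
    lowerFactor r c = ((m * n)! : ℝ) / ((m * n : ℕ) : ℝ) ^ (m * n) *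
      ∏ s, (marginExponent r c s : ℝ) ^ marginExponent r c s / ((marginExponent r c s)! : ℝ) := by
  rw [lowerFactor, Fintype.prod_sum_type, mul_assoc]
  simp only [marginExponent_inl, marginExponent_inr]

theorem lowerFactor_mul_alpha0_le {m n : ℕ} {r : Fin m → ℕ} {c : Fin n → ℕ}
    (hrc : ∑ i, r i = ∑ j, c j) (hr : ∀ i, r i ≤ n) :
    lowerFactor r c * alpha0 r c ≤ ((A0 r c).ncard : ℝ) := by
  refine le_trans ?_ (coeff_bipartiteForm_le hr)
  have h := (isStableForm_bipartiteForm m n).le_coeff (marginExponent r c)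
    (sum_marginExponent hrc hr) (alpha0_nonneg r c) fun w hw => ?_
  · rwa [lowerFactor_eq]
  -- The factor $w_i^{-n}$ produced by $1+y_j/w_i$ combines with $w_i^{r_i}$ into $w_i^{-(n-r_i)}$.
  · have h := alpha0_le_F0 r c (x := fun i => (w (Sum.inl i))⁻¹) (y := fun j => w (Sum.inr j))
      (fun i => inv_pos.2 (hw _)) (fun j => hw _)
    have hM : 0 < ∏ s, w s ^ marginExponent r c s := Finset.prod_pos fun s _ => pow_pos (hw s) _
    rw [← le_div_iff₀ hM]
    refine h.trans_eq ?_
    rw [eq_div_iff hM.ne', bipartiteForm, map_prod, Fintype.prod_prod_type, F0,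
      Fintype.prod_sum_type]
    simp only [zpow_neg, zpow_natCast, inv_pow, inv_inv, marginExponent_inl, marginExponent_inr,
      Finset.prod_inv_distrib, map_add, eval_X]
    have h1 : ∏ i, ∏ j, (1 + (w (Sum.inl i))⁻¹ * w (Sum.inr j)) =
        (∏ i : Fin m, w (Sum.inl i) ^ n)⁻¹ *
          ∏ i, ∏ j, (w (Sum.inr j) + w (Sum.inl i)) := by
      rw [← Finset.prod_inv_distrib, ← Finset.prod_mul_distrib]
      refine Finset.prod_congr rfl fun i _ => ?_
      have : ((w (Sum.inl i) ^ n)⁻¹ : ℝ) = ∏ _j : Fin n, (w (Sum.inl i))⁻¹ := by simp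
      rw [this, ← Finset.prod_mul_distrib]
      refine Finset.prod_congr rfl fun j _ => ?_
      have := (hw (Sum.inl i)).ne'
      field_simp
      ring
    have h2 : ∏ i : Fin m, w (Sum.inl i) ^ n =
        (∏ i, w (Sum.inl i) ^ r i) * ∏ i, w (Sum.inl i) ^ (n - r i) := by
      rw [← Finset.prod_mul_distrib]
      refine Finset.prod_congr rfl fun i _ => ?_
      rw [← pow_add, Nat.add_sub_cancel' (hr i)]
    rw [h1, h2]
    have p1 : ∏ i, w (Sum.inl i) ^ r i ≠ 0 :=
      (Finset.prod_pos fun i _ => pow_pos (hw (Sum.inl i)) _).ne'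
    have p2 : ∏ i, w (Sum.inl i) ^ (n - r i) ≠ 0 :=
      (Finset.prod_pos fun i _ => pow_pos (hw (Sum.inl i)) _).ne'
    have p3 : ∏ j, w (Sum.inr j) ^ c j ≠ 0 :=
      (Finset.prod_pos fun j _ => pow_pos (hw (Sum.inr j)) _).ne'
    field_simp

/-! ### Degenerate margins -/

theorem nonpos_of_forall_le_mul {a K : ℝ} (h : ∀ u, 0 < u → u ≤ 1 → a ≤ K * u) : a ≤ 0 := by
  have hc : Continuous fun u : ℝ => K * u := by fun_prop
  refine ge_of_tendsto (by simpa using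
    (hc.tendsto 0).mono_left (nhdsWithin_le_nhds (s := Set.Ioi (0 : ℝ)))) ?_
  filter_upwards [Ioc_mem_nhdsGT (zero_lt_one (α := ℝ))] with u hu using h u hu.1 hu.2

/-- Along $x=t$, $y=1/t$ every factor $1+x_iy_j$ stays 2, while the monomial prefactor is a nonzero
power of $t$; let $t$ tend to $0$ or $\infty$. -/
theorem alpha0_eq_zero_of_sum_ne {m n : ℕ} {r : Fin m → ℕ} {c : Fin n → ℕ}
    (hrc : ∑ i, r i ≠ ∑ j, c j) : alpha0 r c = 0 := by
  refine le_antisymm ?_ (alpha0_nonneg r c)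
  have hF : ∀ t : ℝ, 0 < t → F0 r c (fun _ => t) (fun _ => t⁻¹) =
      t ^ ((∑ j, c j : ℕ) - (∑ i, r i : ℕ) : ℤ) * 2 ^ (m * n) := by
    intro t ht
    rw [F0]
    simp only [zpow_neg, zpow_natCast, Finset.prod_inv_distrib, Finset.prod_pow_eq_pow_sum, mul_inv_cancel₀ ht.ne', zpow_sub₀ ht.ne']
    simp only [Finset.prod_const, Finset.card_univ, Fintype.card_fin]
    norm_num
    rw [mul_comm m n, pow_mul]
    ring
  refine nonpos_of_forall_le_mul (K := 2 ^ (m * n)) fun u hu hu1 => ?_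
  have key : ∃ t : ℝ, 0 < t ∧ t ^ ((∑ j, c j : ℕ) - (∑ i, r i : ℕ) : ℤ) ≤ u := by
    rcases hrc.lt_or_gt with h | h
    · obtain ⟨k, hk⟩ := Nat.exists_eq_add_of_lt h
      refine ⟨u, hu, ?_⟩
      have : ((∑ j, c j : ℕ) - (∑ i, r i : ℕ) : ℤ) = ((k + 1 : ℕ) : ℤ) := by
        rw [hk]; push_cast; ring
      rw [this, zpow_natCast]
      exact pow_le_of_le_one hu.le hu1 k.succ_ne_zero
    · obtain ⟨k, hk⟩ := Nat.exists_eq_add_of_lt h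
      refine ⟨u⁻¹, inv_pos.2 hu, ?_⟩
      have : ((∑ j, c j : ℕ) - (∑ i, r i : ℕ) : ℤ) = -((k + 1 : ℕ) : ℤ) := by
        rw [hk]; push_cast; ring
      rw [this, zpow_neg, inv_zpow, inv_inv, zpow_natCast]
      exact pow_le_of_le_one hu.le hu1 k.succ_ne_zero
  obtain ⟨t, ht, hle⟩ := key
  have h := alpha0_le_F0 r c (x := fun _ => t) (y := fun _ => t⁻¹) (fun _ => ht)
    (fun _ => inv_pos.2 ht)
  rw [hF t ht] at h
  have : (0 : ℝ) < 2 ^ (m * n) := by positivity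
  nlinarith

/-- Sending $x_i=1/u$ to infinity, all else fixed at 1, makes $x_i^{-r_i}$ outweigh the degree-$n$
growth of $(1+x_i)^n$. -/
theorem alpha0_eq_zero_of_lt {m n : ℕ} {r : Fin m → ℕ} {c : Fin n → ℕ} {i : Fin m}
    (hi : n < r i) : alpha0 r c = 0 := by
  refine le_antisymm ?_ (alpha0_nonneg r c)
  refine nonpos_of_forall_le_mul (K := 2 ^ n * (2 ^ n) ^ (Finset.univ.erase i).card)
    fun u hu hu1 => ?_
  have h := alpha0_le_F0 r c (x := Function.update 1 i u⁻¹) (y := 1)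
    (fun k => by
      rcases eq_or_ne k i with rfl | hk
      · simpa using hu
      · simp [hk]) (by simp)
  refine h.trans ?_
  rw [F0]
  simp only [Pi.one_apply, one_zpow, Finset.prod_const_one, mul_one, Finset.prod_const,
    Finset.card_univ, Fintype.card_fin, ← Finset.prod_mul_distrib]
  rw [← Finset.mul_prod_erase _ _ (Finset.mem_univ i)]
  have h1 : ∏ k ∈ Finset.univ.erase i, ((Function.update 1 i u⁻¹ : Fin m → ℝ) k ^ (-(r k : ℤ)) *
      (1 + (Function.update 1 i u⁻¹ : Fin m → ℝ) k) ^ n) =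
      ∏ _k ∈ Finset.univ.erase i, (2 : ℝ) ^ n := by
    refine Finset.prod_congr rfl fun k hk => ?_
    rw [Function.update_of_ne (Finset.ne_of_mem_erase hk)]
    norm_num
  rw [h1, Finset.prod_const, Function.update_self, mul_right_comm ((2 : ℝ) ^ n) _ u]
  refine mul_le_mul_of_nonneg_right ?_ (by positivity)
  obtain ⟨k, hk⟩ := Nat.exists_eq_add_of_lt hi
  rw [zpow_neg, inv_zpow, inv_inv, zpow_natCast, hk]
  have h2 : u ^ (n + k + 1) * (1 + u⁻¹) ^ n = (1 + u) ^ n * u ^ (k + 1) := by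
    have : (1 + u) ^ n = u ^ n * (1 + u⁻¹) ^ n := by
      rw [← mul_pow]
      congr 1
      field_simp
      ring
    rw [this]
    ring
  rw [h2]
  exact mul_le_mul (pow_le_pow_left₀ (by linarith) (by linarith) n)
    (pow_le_of_le_one hu.le hu1 k.succ_ne_zero) (by positivity) (by positivity)

/-! ### Stirling-type estimates for `lowerFactor` -/

theorem Nat.factorial_mul_exp_le {k : ℕ} (hk : 0 < k) :
    (k ! : ℝ) * Real.exp k ≤ Real.exp 1 * k * (k : ℝ) ^ k := by
  induction k, hk using Nat.le_induction with
  | base => simp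
  | succ k hk ih =>
    have hk' : (0 : ℝ) < k := by exact_mod_cast hk
    -- This is $(1+1/k)^{k+1}\ge e$, from $1-1/(k+1)\le e^{-1/(k+1)}$.
    have hlog : Real.exp 1 * (k : ℝ) ^ (k + 1) ≤ ((k : ℝ) + 1) ^ (k + 1) := by
      have h1 := Real.add_one_le_exp (-(1 / ((k : ℝ) + 1)))
      have h2 : (k : ℝ) / (k + 1) ≤ Real.exp (-(1 / ((k : ℝ) + 1))) := by
        refine le_of_eq_of_le ?_ h1
        field_simp
        ring
      have h3 := pow_le_pow_left₀ (by positivity) h2 (k + 1)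
      rw [← Real.exp_nat_mul] at h3
      have h4 : ((k + 1 : ℕ) : ℝ) * -(1 / ((k : ℝ) + 1)) = -1 := by
        push_cast
        field_simp
      rw [h4, Real.exp_neg, div_pow, div_le_iff₀ (by positivity), inv_mul_eq_div,
        le_div_iff₀ (Real.exp_pos 1)] at h3
      linarith
    rw [Nat.factorial_succ]
    push_cast
    rw [Real.exp_add]
    have h5 := mul_le_mul_of_nonneg_left ih
      (by positivity : (0 : ℝ) ≤ ((k : ℝ) + 1) * Real.exp 1)
    have h6 := mul_le_mul_of_nonneg_left hlog
      (by positivity : (0 : ℝ) ≤ ((k : ℝ) + 1) * Real.exp 1)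
    calc ((k : ℝ) + 1) * k ! * (Real.exp k * Real.exp 1)
        = ((k : ℝ) + 1) * Real.exp 1 * (k ! * Real.exp k) := by ring
      _ ≤ _ := h5
      _ = ((k : ℝ) + 1) * Real.exp 1 * (Real.exp 1 * (k : ℝ) ^ (k + 1)) := by ring
      _ ≤ _ := h6
      _ = _ := by ring

/-- Using $N$ in place of $k$ in the denominator also covers $k=0$. -/
theorem exp_div_le_pow_div_factorial {k N : ℕ} (hN : 0 < N) (hk : k ≤ N) :
    Real.exp k / (Real.exp 1 * N) ≤ (k : ℝ) ^ k / (k ! : ℝ) := by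
  have hN' : (1 : ℝ) ≤ N := by exact_mod_cast hN
  have he : 1 ≤ Real.exp 1 := Real.one_le_exp zero_le_one
  rw [div_le_div_iff₀ (by positivity) (by exact_mod_cast k.factorial_pos)]
  rcases k.eq_zero_or_pos with rfl | hk0
  · simp
    nlinarith
  · have h := Nat.factorial_mul_exp_le hk0
    have hk' : (k : ℝ) ≤ N := by exact_mod_cast hk
    calc Real.exp k * k ! = k ! * Real.exp k := mul_comm _ _
      _ ≤ Real.exp 1 * k * (k : ℝ) ^ k := h
      _ ≤ Real.exp 1 * N * (k : ℝ) ^ k := by gcongr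
      _ = _ := mul_comm _ _

theorem lowerFactor_pos {m n : ℕ} (r : Fin m → ℕ) (c : Fin n → ℕ) : 0 < lowerFactor r c := by
  have h : ∀ k : ℕ, 0 < (k : ℝ) ^ k := fun k => by exact_mod_cast Nat.pow_self_pos
  have hf : ∀ k : ℕ, 0 < (k ! : ℝ) := fun k => by exact_mod_cast k.factorial_pos
  exact mul_pos (mul_pos (div_pos (hf _) (h _))
    (Finset.prod_pos fun i _ => div_pos (h _) (hf _)))
    (Finset.prod_pos fun j _ => div_pos (h _) (hf _))

/-- The exponents sum to $mn$, so the product of the $e^{\alpha_s}$ cancels the $e^{-mn}$ from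
$(mn)!/(mn)^{mn}$. Each of the $m+n$ factors loses $e\,mn$. -/
theorem one_div_lowerFactor_le {m n : ℕ} {r : Fin m → ℕ} {c : Fin n → ℕ} (hmn : 0 < m * n)
    (hrc : ∑ i, r i = ∑ j, c j) (hr : ∀ i, r i ≤ n) :
    1 / lowerFactor r c ≤ (Real.exp 1 * (m * n : ℕ)) ^ (m + n) := by
  have hN' : (0 : ℝ) < (m * n : ℕ) := by exact_mod_cast hmn
  have hsum := sum_marginExponent hrc hr
  set α := marginExponent r c with hα
  have hαle : ∀ s, α s ≤ m * n := fun s =>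
    (Finset.single_le_sum (fun _ _ => Nat.zero_le _) (Finset.mem_univ s)).trans_eq hsum
  have hfac : Real.exp (-(m * n : ℕ)) ≤ ((m * n)! : ℝ) / ((m * n : ℕ) : ℝ) ^ (m * n) := by
    have := Real.pow_div_factorial_le_exp _ hN'.le (m * n)
    rw [Real.exp_neg, inv_le_comm₀ (Real.exp_pos _) (by positivity), inv_div]
    exact this
  have hprod : Real.exp (m * n : ℕ) / (Real.exp 1 * (m * n : ℕ)) ^ (m + n) ≤
      ∏ s, (α s : ℝ) ^ α s / ((α s)! : ℝ) := by
    calc _ = ∏ s, (Real.exp (α s) / (Real.exp 1 * (m * n : ℕ))) := by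
          rw [Finset.prod_div_distrib, ← Real.exp_sum, ← Nat.cast_sum, hsum]
          simp
      _ ≤ _ := Finset.prod_le_prod (fun s _ => by positivity) fun s _ =>
          exp_div_le_pow_div_factorial hmn (hαle s)
  rw [one_div, inv_le_comm₀ (lowerFactor_pos r c) (by positivity), lowerFactor_eq]
  refine le_of_eq_of_le ?_ (mul_le_mul hfac hprod (by positivity) (by positivity))
  rw [← mul_div_assoc, ← Real.exp_add, neg_add_cancel, Real.exp_zero, one_div]

theorem one_div_lowerFactor_le_rpow {m n : ℕ} {r : Fin m → ℕ} {c : Fin n → ℕ}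
    (hr0 : ∀ i, 0 < r i) (hc0 : ∀ j, 0 < c j)
    (hrc : ∑ i, r i = ∑ j, c j) (hr : ∀ i, r i ≤ n) :
    1 / lowerFactor r c ≤ ((m * n : ℕ) : ℝ) ^ ((3 : ℝ) * ((m : ℝ) + (n : ℝ))) := by
  -- For $mn\le1$ the base gives no room: only the empty and the $1\times1$ cases survive, and there
  -- $\lambda=1$.
  rcases Nat.lt_or_ge (m * n) 2 with h | h
  · rcases m.eq_zero_or_pos with rfl | hm
    · rcases n.eq_zero_or_pos with rfl | hn
      · simp [lowerFactor]
      · have : 0 < ∑ j, c j := Finset.sum_pos (fun j _ => hc0 j) ⟨⟨0, hn⟩, Finset.mem_univ _⟩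
        simp at hrc
        omega
    · rcases n.eq_zero_or_pos with rfl | hn
      · have h1 := hr ⟨0, hm⟩
        have h2 := hr0 ⟨0, hm⟩
        omega
      · have hm1 : m = 1 := by nlinarith
        have hn1 : n = 1 := by nlinarith
        subst hm1 hn1
        have h1 : r 0 = 1 := le_antisymm (hr 0) (hr0 0)
        have h2 : c 0 = 1 := by simpa [h1] using hrc.symm
        simp [lowerFactor, h1, h2]
  -- For $N=mn\ge2$, $eN\le N^3$ because $e<4\le N^2$; hence the exponent 3.
  · refine (one_div_lowerFactor_le (by omega) hrc hr).trans ?_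
    have h2 : (2 : ℝ) ≤ (m * n : ℕ) := by exact_mod_cast h
    have h3 : (3 : ℝ) * ((m : ℝ) + (n : ℝ)) = ((3 * (m + n) : ℕ) : ℝ) := by push_cast; ring
    rw [h3, Real.rpow_natCast, pow_mul]
    refine pow_le_pow_left₀ (by positivity) ?_ _
    have := Real.exp_one_lt_d9
    nlinarith [mul_nonneg (sub_nonneg.2 h2) (sub_nonneg.2 h2)]

end

/-! ### Assembly of the theorem -/

theorem theorem2p1 :
    (∀ (m n : ℕ) (r : Fin m → ℕ) (c : Fin n → ℕ), (∀ i, 0 < r i) → (∀ j, 0 < c j) →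
      ((A0 r c).ncard : ℝ) ≤ alpha0 r c ∧
      lowerFactor r c * alpha0 r c ≤ ((A0 r c).ncard : ℝ)) ∧
    ∃ γ : ℝ, 0 < γ ∧
      ∀ (m n : ℕ) (r : Fin m → ℕ) (c : Fin n → ℕ), (∀ i, 0 < r i) → (∀ j, 0 < c j) →
        (∑ i, r i = ∑ j, c j → (∀ i, r i ≤ n) →
          1 / lowerFactor r c ≤ ((m * n : ℕ) : ℝ) ^ (γ * ((m : ℝ) + (n : ℝ)))) ∧
        alpha0 r c ≤
          ((m * n : ℕ) : ℝ) ^ (γ * ((m : ℝ) + (n : ℝ))) * ((A0 r c).ncard : ℝ) := by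
  have hzero : ∀ (m n : ℕ) (r : Fin m → ℕ) (c : Fin n → ℕ),
      ¬(∑ i, r i = ∑ j, c j ∧ ∀ i, r i ≤ n) → alpha0 r c = 0 := by
    intro m n r c h
    by_cases hrc : ∑ i, r i = ∑ j, c j
    · obtain ⟨i, hi⟩ : ∃ i, n < r i := by
        by_contra! hr
        exact h ⟨hrc, hr⟩
      exact alpha0_eq_zero_of_lt hi
    · exact alpha0_eq_zero_of_sum_ne hrc
  refine ⟨fun m n r c _ _ => ⟨ncard_A0_le_alpha0 r c, ?_⟩, 3, by norm_num,
    fun m n r c hr0 hc0 => ⟨one_div_lowerFactor_le_rpow hr0 hc0, ?_⟩⟩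
  · by_cases h : ∑ i, r i = ∑ j, c j ∧ ∀ i, r i ≤ n
    · exact lowerFactor_mul_alpha0_le h.1 h.2
    · simp [hzero m n r c h]
  · by_cases h : ∑ i, r i = ∑ j, c j ∧ ∀ i, r i ≤ n
    · have h1 := lowerFactor_mul_alpha0_le h.1 h.2
      have h2 := one_div_lowerFactor_le_rpow hr0 hc0 h.1 h.2
      rw [mul_comm, ← le_div_iff₀ (lowerFactor_pos r c)] at h1
      refine h1.trans ?_
      rw [div_eq_mul_one_div, mul_comm]
      exact mul_le_mul_of_nonneg_right h2 (Nat.cast_nonneg _)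
    · rw [hzero m n r c h]
      positivity
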